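/- Let $\kappa$ be an uncountable cardinal and $S$ a set of cardinality $\kappa$; give $[0,1]^S$ the product topology. Call a subspace $X\subseteq[0,1]^S$ a *Uspenskii example* over $S$ if (i) $X$ is dense in $[0,1]^S$; (ii) $X$ is the union of countably many subsets, each of cardinality $|S|$, closed in $X$, and discrete in the subspace topology; (iii) for every $f\in X$ the set $\{\alpha\in S: f(\alpha)\neq 0\}$ is finite; (iv) there is a countable set $C\subseteq[0,1]$ such that $f[S]\subseteq C$ for every $f\in X$. **Theorem.** Uspenskii examples over $S$ exist. Every Uspenskii example $X$ over $S$ has cardinality $\kappa$, is functionally countable, has a $G_\delta$ diagonal, has extent $\kappa$, and is not exponentially separable. Here $X$ is *functionally countable* if every continuous $f\colon X\to\mathbb{R}$ has countable image. $X$ has a *$G_\delta$ diagonal* if $\{(x,x):x\in X\}$ is a $G_\delta$ subset of $X\times X$. The *extent* of $X$ is $\max(\aleph_0,\sup\{|D| : D\subseteq X \text{ closed and discrete}\})$. $X$ is *exponentially separable* if for every countable family $\mathcal F$ of closed subsets of $X$ there is a countable $A\subseteq X$ such that $A\cap\bigcap\mathcal G\neq\emptyset$ for every $\mathcal G\subseteq\mathcal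 F$ with $\bigcap\mathcal G\neq\emptyset$ (where $\bigcap\emptyset=X$). -/

import Mathlib

universe u

open Set Cardinal

/-- Every continuous real-valued function on `X` has countable image. -/
def FunctionallyCountable (X : Type*) [TopologicalSpace X] : Prop :=
  ∀ f : X → ℝ, Continuous f → (range f).Countable

/-- `A` meets `⋂ 𝒢` for every subfamily `𝒢 ⊆ ℱ` whose intersection is nonempty
(the intersection of the empty subfamily is the whole space). -/
def StronglyDenseIn {X : Type*} (A : Set X) (ℱ : Set (Set X)) : Prop :=
  ∀ 𝒢 : Set (Set X), 𝒢 ⊆ ℱ → (⋂₀ 𝒢).Nonempty → (A ∩ ⋂₀ 𝒢).Nonempty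

/-- Every countable family of closed sets admits a countable strongly dense set. -/
def ExponentiallySeparable (X : Type*) [TopologicalSpace X] : Prop :=
  ∀ ℱ : Set (Set X), ℱ.Countable → (∀ F ∈ ℱ, IsClosed F) →
    ∃ A : Set X, A.Countable ∧ StronglyDenseIn A ℱ

/-- The extent of `X`: the supremum of the cardinalities of the closed discrete subsets of `X`,
with the usual convention that the value is at least `ℵ₀`. -/
noncomputable def extent (X : Type*) [TopologicalSpace X] : Cardinal :=
  max ℵ₀ (⨆ D : {D : Set X // IsClosed D ∧ IsDiscrete D}, #(D : Set X))

/-- The defining properties of Uspenskii's examples: `X` is a dense subspace of the Tychonoff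
cube `[0,1]^S`, it is the union of countably many closed (in `X`) discrete subspaces of
cardinality `|S|`, its elements have finite support, and the values of all its elements lie in
one countable subset of `[0,1]`. -/
structure IsUspenskiiExample {S : Type*} (X : Set (S → unitInterval)) : Prop where
  dense : Dense X
  sigma_closed_discrete : ∃ D : ℕ → Set X,
    (∀ n, IsClosed (D n) ∧ IsDiscrete (D n) ∧ #(D n) = #S) ∧ ⋃ n, D n = Set.univ
  finite_support : ∀ f ∈ X, {α : S | f α ≠ 0}.Finite
  countable_values : ∃ C : Set unitInterval, C.Countable ∧ ∀ f ∈ X, range f ⊆ C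

open MeasureTheory unitInterval

/-! Product Lebesgue measure gives nonempty open boxes positive mass, so disjoint families of them
are countable, and a continuous real function on a dense subspace depends on a countable set `A` of
coordinates (`exists_countable_coords_of_continuous`). Finite supports and countably many values
leave only countably many restrictions to `A`, whence functional countability. The other properties
come from the closed discrete pieces, all of whose subsets are closed. For existence, level `n`
consists of points with exactly `n + 1` nonzero values, each an odd multiple of `2⁻ⁿ`. The
denominator identifies the level, making it closed in the union; the fixed support size makes it
discrete; fine dyadics give density. -/

lemma volume_pos_of_isOpen_unitInterval {U : Set I} (hU : IsOpen U) (hne : U.Nonempty) :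
    volume U ≠ 0 := by
  obtain ⟨a, b, hab, hsub⟩ := hU.exists_Ioo_subset hne
  have h : 0 < volume (Ioo a b) := by
    rw [unitInterval.volume_Ioo]
    exact ENNReal.ofReal_pos.2 (sub_pos.2 hab)
  exact (h.trans_le (measure_mono hsub)).ne'

/-- The countable chain condition for basic open boxes of the cube `[0,1]^S`. -/
lemma countable_of_pairwiseDisjoint_boxes {S : Type*} (c : Set (Finset S × (S → Set I)))
    (hopen : ∀ b ∈ c, ∀ i ∈ b.1, IsOpen (b.2 i))
    (hne : ∀ b ∈ c, ∀ i ∈ b.1, (b.2 i).Nonempty)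
    (hdisj : c.PairwiseDisjoint fun b => (b.1 : Set S).pi b.2) : c.Countable := by
  -- A probability measure admits only countably many disjoint measurable sets of positive measure.
  have key := Measure.countable_meas_pos_of_disjoint_iUnion
    (μ := Measure.infinitePi fun _ : S => (volume : Measure I))
    (As := fun b : c => (b.1.1 : Set S).pi b.1.2)
    (fun b => MeasurableSet.pi b.1.1.countable_toSet
      fun i hi => (hopen b b.2 i hi).measurableSet)
    (fun a b hab => hdisj a.2 b.2 fun h => hab (Subtype.ext h))
  have huniv : {b : c | 0 < Measure.infinitePi (fun _ : S => (volume : Measure I))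
      ((b.1.1 : Set S).pi b.1.2)} = Set.univ := by
    refine eq_univ_of_forall fun b => ?_
    rw [mem_ofPred_eq, Measure.infinitePi_pi _ fun i hi => (hopen b b.2 i hi).measurableSet,
      pos_iff_ne_zero, Finset.prod_ne_zero_iff]
    exact fun i hi => volume_pos_of_isOpen_unitInterval (hopen b b.2 i hi) (hne b b.2 i hi)
  rw [huniv, countable_univ_iff] at key
  exact countable_coe_iff.1 key

/-- The closure of an open subset of the cube depends on countably many coordinates. -/
lemma exists_countable_coords_of_isOpen {S : Type*} {W : Set (S → I)} (hW : IsOpen W) :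
    ∃ A : Set S, A.Countable ∧ ∀ x ∈ W, ∀ y, EqOn x y A → y ∈ closure W := by
  classical
  let box : Finset S × (S → Set I) → Set (S → I) := fun b => (b.1 : Set S).pi b.2
  let P : Set (Finset S × (S → Set I)) :=
    {b | (∀ i ∈ b.1, IsOpen (b.2 i)) ∧ (∀ i ∈ b.1, (b.2 i).Nonempty) ∧ box b ⊆ W}
  -- A maximal disjoint family of boxes inside `W`; its coordinates will form `A`.
  obtain ⟨c, hc⟩ := zorn_subset {c | c ⊆ P ∧ c.PairwiseDisjoint box} (by
    intro C hC hchain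
    refine ⟨⋃₀ C, ⟨sUnion_subset fun s hs => (hC hs).1, ?_⟩, fun s hs => subset_sUnion_of_mem hs⟩
    exact (pairwiseDisjoint_sUnion hchain.directedOn).2 fun s hs => (hC hs).2)
  have hcP : c ⊆ P := hc.prop.1
  have hcount : c.Countable := countable_of_pairwiseDisjoint_boxes c
    (fun b hb => (hcP hb).1) (fun b hb => (hcP hb).2.1) hc.prop.2
  refine ⟨⋃ b ∈ c, (b.1 : Set S), hcount.biUnion fun b _ => b.1.countable_toSet, ?_⟩
  set A : Set S := ⋃ b ∈ c, (b.1 : Set S) with hA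
  intro x hx y hxy
  by_contra hy
  obtain ⟨F, u, hu, hsub⟩ := isOpen_pi_iff.1 isClosed_closure.isOpen_compl y hy
  obtain ⟨G, v, hv, hvsub⟩ := isOpen_pi_iff.1 hW x hx
  -- a box around `x` inside `W`, contained in the box of `y` on the coordinates of `A`
  let w : S → Set I := fun i =>
    (if i ∈ G then v i else univ) ∩ (if i ∈ F ∧ i ∈ A then u i else univ)
  have hw : ∀ i, IsOpen (w i) ∧ x i ∈ w i := by
    intro i
    have h1 : IsOpen (if i ∈ G then v i else univ) ∧ x i ∈ (if i ∈ G then v i else univ) := by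
      split_ifs with h
      · exact hv i h
      · exact ⟨isOpen_univ, mem_univ _⟩
    have h2 : IsOpen (if i ∈ F ∧ i ∈ A then u i else univ) ∧
        x i ∈ (if i ∈ F ∧ i ∈ A then u i else univ) := by
      split_ifs with h
      · rw [hxy h.2]
        exact hu i h.1
      · exact ⟨isOpen_univ, mem_univ _⟩
    exact ⟨h1.1.inter h2.1, h1.2, h2.2⟩
  have hbW : box (G ∪ F, w) ⊆ W := by
    intro z hz
    refine hvsub fun i hi => ?_
    have := (hz i (by simp [Finset.mem_coe.1 hi])).1
    rwa [if_pos (Finset.mem_coe.1 hi)] at this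
  have hmeet : ∃ b ∈ c, (box b ∩ box (G ∪ F, w)).Nonempty := by
    by_contra! hno
    have hmem : insert (G ∪ F, w) c ∈ {c | c ⊆ P ∧ c.PairwiseDisjoint box} := by
      refine ⟨insert_subset ⟨fun i _ => (hw i).1, fun i _ => ⟨_, (hw i).2⟩, hbW⟩ hcP, ?_⟩
      refine hc.prop.2.insert fun b hb _ => ?_
      rw [disjoint_comm, disjoint_iff_inter_eq_empty]
      exact hno b hb
    have hin : (G ∪ F, w) ∈ c := hc.le_of_ge hmem (subset_insert _ _) (mem_insert _ _)
    have hxin : x ∈ box (G ∪ F, w) := fun i _ => (hw i).2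
    exact (hno _ hin).le ⟨hxin, hxin⟩
  obtain ⟨b, hb, z, hzb, hz⟩ := hmeet
  -- Splice: membership in the box of `b` only sees `A`, so `z'` stays in `W`; yet `z'` lies in the
  -- neighbourhood of `y` that misses `closure W`.
  let z' : S → I := fun i => if i ∈ A then z i else y i
  have hz'W : z' ∈ W := by
    refine (hcP hb).2.2 fun i hi => ?_
    have hiA : i ∈ A := mem_biUnion hb hi
    simpa only [z', if_pos hiA] using hzb i hi
  refine hsub (a := z') (fun i hi => ?_) (subset_closure hz'W)
  by_cases hiA : i ∈ A
  · have := (hz i (by simp [Finset.mem_coe.1 hi])).2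
    rw [if_pos ⟨Finset.mem_coe.1 hi, hiA⟩] at this
    simpa only [z', if_pos hiA] using this
  · simpa only [z', if_neg hiA] using (hu i hi).2

/-- A continuous real function on a dense subspace of the cube depends on countably many
coordinates. -/
lemma exists_countable_coords_of_continuous {S : Type*} {X : Set (S → I)} (hX : Dense X)
    {f : X → ℝ} (hf : Continuous f) :
    ∃ A : Set S, A.Countable ∧ ∀ x y : X, EqOn (x : S → I) y A → f x = f y := by
  have hW : ∀ U : Set ℝ, ∃ W : Set (S → I), IsOpen U → IsOpen W ∧ Subtype.val ⁻¹' W = f ⁻¹' U := by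
    intro U
    by_cases hU : IsOpen U
    · obtain ⟨W, h1, h2⟩ := isOpen_induced_iff.1 (hU.preimage hf)
      exact ⟨W, fun _ => ⟨h1, h2⟩⟩
    · exact ⟨∅, fun h => (hU h).elim⟩
  choose W hW using hW
  have hA : ∀ U : Set ℝ, ∃ A : Set S, A.Countable ∧
      (IsOpen U → ∀ x ∈ W U, ∀ y, EqOn x y A → y ∈ closure (W U)) := by
    intro U
    by_cases hU : IsOpen U
    · obtain ⟨A, h1, h2⟩ := exists_countable_coords_of_isOpen (hW U hU).1
      exact ⟨A, h1, fun _ => h2⟩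
    · exact ⟨∅, countable_empty, fun h => (hU h).elim⟩
  choose A hAc hA using hA
  have hB := TopologicalSpace.isBasis_countableBasis ℝ
  refine ⟨⋃ U ∈ TopologicalSpace.countableBasis ℝ, A U,
    (TopologicalSpace.countable_countableBasis ℝ).biUnion fun U _ => hAc U, fun x y hxy => ?_⟩
  by_contra hne
  obtain ⟨O, O', hO, hO', hxO, hyO, hdisj⟩ := t2_separation hne
  obtain ⟨U, hUB, hxU, hUO⟩ := hB.exists_subset_of_mem_open hxO hO
  have hU := hB.isOpen hUB
  have hxW : (x : S → I) ∈ W U := by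
    have : x ∈ Subtype.val ⁻¹' W U := by rw [(hW U hU).2]; exact hxU
    exact this
  have hyW : (y : S → I) ∈ W O' := by
    have : y ∈ Subtype.val ⁻¹' W O' := by rw [(hW O' hO').2]; exact hyO
    exact this
  have hycl := hA U hU x hxW y (hxy.mono (subset_biUnion_of_mem (u := A) hUB))
  have hmeet := mem_closure_iff.1 hycl _ (hW O' hO').1 hyW
  obtain ⟨z, hz, hzX⟩ := hX.inter_open_nonempty _ ((hW O' hO').1.inter (hW U hU).1) hmeet
  have h1 : (⟨z, hzX⟩ : X) ∈ f ⁻¹' O' := by rw [← (hW O' hO').2]; exact hz.1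
  have h2 : (⟨z, hzX⟩ : X) ∈ f ⁻¹' U := by rw [← (hW U hU).2]; exact hz.2
  exact disjoint_left.1 hdisj (hUO h2) h1

lemma IsUspenskiiExample.functionallyCountable {S : Type*} {X : Set (S → I)}
    (hX : IsUspenskiiExample X) : FunctionallyCountable X := by
  intro f hf
  obtain ⟨A, hA, hfA⟩ := exists_countable_coords_of_continuous hX.dense hf
  obtain ⟨C, hC, hXC⟩ := hX.countable_values
  -- The graph of `x` over `A` without its zeros: a finite subset of the countable set `A ×ˢ C`.
  let T : X → Set (S × I) := fun x => {p | p.1 ∈ A ∧ p.2 = x.1 p.1 ∧ p.2 ≠ 0}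
  have hT : (range T).Countable := by
    refine (countable_ofPred_finite_subset (hA.prod hC)).mono ?_
    rintro _ ⟨x, rfl⟩
    refine ⟨((hX.finite_support x x.2).image fun α => (α, x.1 α)).subset ?_, ?_⟩
    · rintro ⟨α, t⟩ ⟨-, h2, h3⟩
      simp only at h2 h3
      subst h2
      exact ⟨α, h3, rfl⟩
    · rintro ⟨α, t⟩ ⟨h1, h2, -⟩
      exact ⟨h1, h2 ▸ hXC x x.2 (mem_range_self α)⟩
  have hfac : Function.FactorsThrough f T := by
    intro x y hxy
    have aux : ∀ x y : X, T x = T y → ∀ α ∈ A, x.1 α ≠ 0 → x.1 α = y.1 α := by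
      intro x y hxy α hα h0
      have : (α, x.1 α) ∈ T y := hxy ▸ ⟨hα, rfl, h0⟩
      exact this.2.1
    refine hfA x y fun α hα => ?_
    by_cases h0 : x.1 α = 0
    · by_cases h1 : y.1 α = 0
      · rw [h0, h1]
      · exact (aux y x hxy.symm α hα h1).symm
    · exact aux x y hxy α hα h0
  refine (hT.image (Function.extend T f 0)).mono ?_
  rintro _ ⟨x, rfl⟩
  exact ⟨T x, mem_range_self x, hfac.extend_apply 0 x⟩

/-! ### Consequences of the closed discrete pieces -/

lemma IsDiscrete.prod_set {X Y : Type*} [TopologicalSpace X] [TopologicalSpace Y]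
    {s : Set X} {t : Set Y} (hs : IsDiscrete s) (ht : IsDiscrete t) : IsDiscrete (s ×ˢ t) := by
  rw [isDiscrete_iff_forall_mem_exists_isOpen] at *
  rintro ⟨x, y⟩ ⟨hx, hy⟩
  obtain ⟨u, hu, hux⟩ := hs x hx
  obtain ⟨v, hv, hvy⟩ := ht y hy
  exact ⟨u ×ˢ v, hu.prod hv, by rw [prod_inter_prod, hux, hvy, singleton_prod_singleton]⟩

/-- In a countable union of closed discrete sets the diagonal is a `Gδ` set. -/
lemma isGδ_diagonal_of_iUnion_closed_discrete {X : Type*} [TopologicalSpace X] {D : ℕ → Set X}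
    (hD : ∀ n, IsClosed (D n) ∧ IsDiscrete (D n)) (hU : ⋃ n, D n = Set.univ) :
    IsGδ (diagonal X) := by
  have h : diagonal X = ⋂ p : ℕ × ℕ, ((D p.1 ×ˢ D p.2) \ diagonal X)ᶜ := by
    refine subset_antisymm (subset_iInter fun p x hx hx' => hx'.2 hx) fun x hx => ?_
    by_contra hxd
    obtain ⟨n, hn⟩ := mem_iUnion.1 (hU ▸ mem_univ x.1)
    obtain ⟨m, hm⟩ := mem_iUnion.1 (hU ▸ mem_univ x.2)
    exact mem_iInter.1 hx (n, m) ⟨⟨hn, hm⟩, hxd⟩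
  rw [h]
  exact .iInter_of_isOpen fun p => (isClosed_of_subset_discrete_closed sdiff_subset
    ((hD p.1).2.prod_set (hD p.2).2) ((hD p.1).1.prod (hD p.2).1)).isOpen_compl

/-- An exponentially separable space has no uncountable closed discrete subset. -/
lemma not_exponentiallySeparable_of_closed_discrete {X : Type*} [TopologicalSpace X] {D : Set X}
    (hDc : IsClosed D) (hDd : IsDiscrete D) (hD : ℵ₀ < #D) : ¬ ExponentiallySeparable X := by
  classical
  intro h
  -- Passing to `ℵ₁` points allows an injection into `Set ℕ`, since `ℵ₁ ≤ 𝔠`.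
  obtain ⟨E, hED, hE⟩ := le_mk_iff_exists_subset.1 (Order.succ_le_of_lt hD)
  have hinj : lift.{0} #E ≤ lift #(Set ℕ) := by
    rw [hE, mk_set, mk_nat, lift_two_power, lift_aleph0, two_power_aleph0, lift_uzero]
    exact Order.succ_le_of_lt aleph0_lt_continuum
  obtain ⟨g⟩ := lift_mk_le'.1 hinj
  -- The points of `E` with a prescribed binary digit; fixing all digits isolates a single point.
  let F : ℕ × Bool → Set X := fun p => {x | ∃ hx : x ∈ E, decide (p.1 ∈ g ⟨x, hx⟩) = p.2}
  obtain ⟨A, hA, hdense⟩ := h (range F) (countable_range F) (by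
    rintro _ ⟨p, rfl⟩
    refine isClosed_of_subset_discrete_closed ?_ hDd hDc
    rintro x ⟨hx, -⟩
    exact hED hx)
  have hEA : E ⊆ A := by
    intro x hx
    let 𝒢 : Set (Set X) := range fun n : ℕ => F (n, decide (n ∈ g ⟨x, hx⟩))
    obtain ⟨y, hyA, hy⟩ := hdense 𝒢 (by rintro _ ⟨n, rfl⟩; exact mem_range_self _)
      ⟨x, by rintro _ ⟨n, rfl⟩; exact ⟨hx, rfl⟩⟩
    have hyn : ∀ n, y ∈ F (n, decide (n ∈ g ⟨x, hx⟩)) := fun n => hy _ (mem_range_self n)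
    obtain ⟨hyE, -⟩ := hyn 0
    have hxy : g ⟨y, hyE⟩ = g ⟨x, hx⟩ := by
      ext n
      obtain ⟨_, hn⟩ := hyn n
      exact decide_eq_decide.1 hn
    have : y = x := congrArg Subtype.val (g.injective hxy)
    exact this ▸ hyA
  have := le_aleph0_iff_set_countable.2 (hA.mono hEA)
  rw [hE] at this
  exact (Order.lt_succ ℵ₀).not_ge this

lemma IsUspenskiiExample.mk_eq {S : Type u} (hS : ℵ₀ ≤ #S) {X : Set (S → I)}
    (hX : IsUspenskiiExample X) : #X = #S := by
  obtain ⟨D, hD, hU⟩ := hX.sigma_closed_discrete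
  apply le_antisymm
  · rw [← mk_univ, ← hU]
    have h := mk_iUnion_le_lift D
    simp only [(hD _).2.2, mk_nat, lift_aleph0, ciSup_const] at h
    rw [lift_uzero, lift_uzero] at h
    exact h.trans (aleph0_mul_eq hS).le
  · rw [← (hD 0).2.2]
    exact mk_set_le _

lemma IsUspenskiiExample.extent_eq {S : Type u} (hS : ℵ₀ ≤ #S) {X : Set (S → I)}
    (hX : IsUspenskiiExample X) : extent X = #S := by
  obtain ⟨D, hD, -⟩ := hX.sigma_closed_discrete
  apply le_antisymm
  · exact max_le hS (ciSup_le' fun E => (mk_set_le _).trans (hX.mk_eq hS).le)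
  · refine le_max_of_le_right ?_
    rw [← (hD 0).2.2]
    exact le_ciSup (f := fun E : {D : Set X // IsClosed D ∧ IsDiscrete D} => #(E : Set X))
      bddAbove_of_small ⟨D 0, (hD 0).1, (hD 0).2.1⟩

/-! ### Existence: the dyadic example -/

/-- Dyadic points of the unit interval with exact denominator `2 ^ n`. -/
def dyadicPoints (n : ℕ) : Set I := {t | ∃ k : ℕ, Odd k ∧ (t : ℝ) * 2 ^ n = k}

lemma finite_dyadicPoints (n : ℕ) : (dyadicPoints n).Finite := by
  refine Set.Finite.of_finite_image (f := fun t : I => (t : ℝ) * 2 ^ n) ?_ ?_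
  · refine ((Set.finite_Iic (2 ^ n)).image (Nat.cast : ℕ → ℝ)).subset ?_
    rintro _ ⟨t, ⟨k, -, hk⟩, rfl⟩
    refine ⟨k, ?_, hk.symm⟩
    have : (k : ℝ) ≤ 2 ^ n := by
      rw [← hk]
      exact mul_le_of_le_one_left (by positivity) t.2.2
    exact_mod_cast this
  · intro s _ t _ h
    exact Subtype.ext (mul_right_cancel₀ (by positivity) h)

lemma ne_zero_of_mem_dyadicPoints {n : ℕ} {t : I} (ht : t ∈ dyadicPoints n) : t ≠ 0 := by
  rintro rfl
  obtain ⟨k, hk, h⟩ := ht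
  simp only [Icc.coe_zero, zero_mul] at h
  have : k = 0 := by exact_mod_cast h.symm
  simp [this] at hk

lemma eq_of_mem_dyadicPoints {n m : ℕ} {t : I} (hn : t ∈ dyadicPoints n)
    (hm : t ∈ dyadicPoints m) : n = m := by
  have aux : ∀ {n m : ℕ}, t ∈ dyadicPoints n → t ∈ dyadicPoints m → ¬ n < m := by
    rintro n m ⟨k, -, hk⟩ ⟨l, hl, hl'⟩ hlt
    obtain ⟨d, rfl⟩ := Nat.exists_eq_add_of_lt hlt
    have : (l : ℝ) = 2 * (k * 2 ^ d : ℕ) := by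
      rw [← hl']
      push_cast
      rw [← hk]
      ring
    have : l = 2 * (k * 2 ^ d) := by exact_mod_cast this
    exact (Nat.not_even_iff_odd.2 hl) (this ▸ even_two_mul _)
  exact le_antisymm (not_lt.1 (aux hm hn)) (not_lt.1 (aux hn hm))

lemma eventually_dyadicPoints_inter_nonempty {U : Set I} (hU : IsOpen U) (hne : U.Nonempty) :
    ∀ᶠ n in Filter.atTop, (dyadicPoints n ∩ U).Nonempty := by
  obtain ⟨a, b, hab, hsub⟩ := hU.exists_Ioo_subset hne
  have hab' : (0 : ℝ) < b - a := sub_pos.2 hab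
  have hlim : Filter.Tendsto (fun n : ℕ => (2 : ℝ) ^ n) Filter.atTop Filter.atTop :=
    tendsto_pow_atTop_atTop_of_one_lt one_lt_two
  filter_upwards [hlim.eventually_gt_atTop (3 / ((b : ℝ) - a))] with n hn
  rw [div_lt_iff₀ hab'] at hn
  have hpos : (0 : ℝ) < 2 ^ n := by positivity
  have ha0 : (0 : ℝ) ≤ a * 2 ^ n / 2 := by have := a.2.1; positivity
  set m := ⌊(a : ℝ) * 2 ^ n / 2⌋₊ with hm
  have h1 : (m : ℝ) ≤ a * 2 ^ n / 2 := Nat.floor_le ha0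
  have h2 : (a : ℝ) * 2 ^ n / 2 < m + 1 := Nat.lt_floor_add_one _
  -- An odd integer in `(a * 2 ^ n, a * 2 ^ n + 3]`, hence the threshold `3 / (b - a)`; `2 * m + 1`
  -- might not exceed `a * 2 ^ n`.
  set k : ℕ := 2 * (m + 1) + 1 with hk
  have hkr : (k : ℝ) = 2 * (m + 1) + 1 := by rw [hk]; push_cast; ring
  have hka : (a : ℝ) < k / 2 ^ n := by
    rw [lt_div_iff₀ hpos]
    linarith
  have hkb : (k : ℝ) / 2 ^ n < b := by
    rw [div_lt_iff₀ hpos]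
    linarith
  refine ⟨⟨k / 2 ^ n, by positivity, (hkb.trans_le b.2.2).le⟩, ⟨k, ⟨m + 1, rfl⟩, ?_⟩,
    hsub ⟨hka, hkb⟩⟩
  exact div_mul_cancel₀ _ hpos.ne'

/-- Points of the cube with support of size `n + 1` all of whose nonzero values are dyadic
with exact denominator `2 ^ n`. -/
def dyadicLevel (S : Type*) (n : ℕ) : Set (S → I) :=
  {x | {α | x α ≠ 0}.ncard = n + 1 ∧ ∀ α, x α ≠ 0 → x α ∈ dyadicPoints n}

lemma finite_support_of_mem_dyadicLevel {S : Type*} {n : ℕ} {x : S → I}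
    (hx : x ∈ dyadicLevel S n) : {α | x α ≠ 0}.Finite :=
  finite_of_ncard_ne_zero (by rw [hx.1]; omega)

lemma exists_mem_dyadicPoints_of_mem_dyadicLevel {S : Type*} {n : ℕ} {x : S → I}
    (hx : x ∈ dyadicLevel S n) : ∃ α, x α ∈ dyadicPoints n := by
  obtain ⟨α, hα⟩ := nonempty_of_ncard_ne_zero (by rw [hx.1]; omega : {α | x α ≠ 0}.ncard ≠ 0)
  exact ⟨α, hx.2 α hα⟩

lemma isClosed_setOf_mem_insert_dyadicPoints (S : Type*) (n : ℕ) :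
    IsClosed {x : S → I | ∀ α, x α ∈ insert 0 (dyadicPoints n)} := by
  simp only [ofPred_forall]
  exact isClosed_iInter fun α =>
    ((finite_dyadicPoints n).insert 0).isClosed.preimage (continuous_apply α)

/-- Every point of a level has a nonzero value, whose exact denominator reveals the level. This
yields relative closedness. -/
lemma dyadicLevel_eq_inter (S : Type*) (n : ℕ) : dyadicLevel S n =
    (⋃ m, dyadicLevel S m) ∩ {x | ∀ α, x α ∈ insert 0 (dyadicPoints n)} := by
  ext x
  constructor
  · intro hx
    exact ⟨mem_iUnion_of_mem n hx, fun α => or_iff_not_imp_left.2 (hx.2 α)⟩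
  · rintro ⟨hx, hxn⟩
    obtain ⟨m, hm⟩ := mem_iUnion.1 hx
    obtain ⟨α, hα⟩ := exists_mem_dyadicPoints_of_mem_dyadicLevel hm
    have hαn := (hxn α).resolve_left (ne_zero_of_mem_dyadicPoints hα)
    exact eq_of_mem_dyadicPoints hα hαn ▸ hm

lemma isDiscrete_dyadicLevel (S : Type*) (n : ℕ) : IsDiscrete (dyadicLevel S n) := by
  rw [isDiscrete_iff_forall_mem_exists_isOpen]
  intro x hx
  have hfin := finite_support_of_mem_dyadicLevel hx
  refine ⟨{α | x α ≠ 0}.pi fun α => (insert 0 (dyadicPoints n) \ {x α})ᶜ,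
    isOpen_set_pi hfin fun α _ =>
      (((finite_dyadicPoints n).insert 0).sdiff).isClosed.isOpen_compl, ?_⟩
  refine subset_antisymm ?_ (singleton_subset_iff.2 ⟨fun α _ h => h.2 rfl, hx⟩)
  rintro y ⟨hy, hyn⟩
  have heq : ∀ α, x α ≠ 0 → y α = x α := by
    intro α hα
    by_contra hne
    exact hy α hα ⟨or_iff_not_imp_left.2 (hyn.2 α), hne⟩
  -- `y` is nonzero wherever `x` is, and both supports have `n + 1` elements.
  have hsupp : {α | x α ≠ 0} = {α | y α ≠ 0} := by
    refine eq_of_subset_of_ncard_le (fun α hα => ?_) (by rw [hx.1, hyn.1])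
      (finite_support_of_mem_dyadicLevel hyn)
    rw [mem_ofPred_eq, heq α hα]
    exact hα
  refine funext fun α => ?_
  by_cases hα : x α = 0
  · have : ¬ y α ≠ 0 := fun h => (hsupp.symm ▸ h : α ∈ {α | x α ≠ 0}) hα
    rw [hα, not_not.1 this]
  · exact heq α hα

/-- A finite set of prescribed nonzero dyadic values can be extended to a point of a level. -/
lemma exists_mem_dyadicLevel {S : Type*} [Infinite S] {n : ℕ} (F : Finset S)
    (hF : F.card ≤ n + 1) (v : S → I) (hv : ∀ α ∈ F, v α ∈ dyadicPoints n) {t : I}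
    (ht : t ∈ dyadicPoints n) : ∃ x ∈ dyadicLevel S n, ∀ α ∈ F, x α = v α := by
  classical
  obtain ⟨G, hFG, hG⟩ := Infinite.exists_superset_card_eq F (n + 1) hF
  let x : S → I := fun α => if α ∈ F then v α else if α ∈ G then t else 0
  have hxG : ∀ α ∈ G, x α ∈ dyadicPoints n := by
    intro α hα
    by_cases h : α ∈ F
    · simpa only [x, if_pos h] using hv α h
    · simpa only [x, if_neg h, if_pos hα] using ht
  have hxG' : ∀ α, α ∉ G → x α = 0 := by
    intro α hα
    simp only [x, if_neg hα, if_neg fun h => hα (hFG h)]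
  have hsupp : {α | x α ≠ 0} = (G : Set S) := by
    ext α
    exact ⟨fun h => by_contra fun hα => h (hxG' α hα),
      fun hα => ne_zero_of_mem_dyadicPoints (hxG α hα)⟩
  refine ⟨x, ⟨by rw [hsupp, ncard_coe_finset, hG], fun α hα => hxG α ?_⟩,
    fun α hα => by simp only [x, if_pos hα]⟩
  exact (hsupp ▸ hα : α ∈ (G : Set S))

lemma dyadicPoints_nonempty (n : ℕ) : (dyadicPoints n).Nonempty := by
  refine ⟨⟨1 / 2 ^ n, by positivity, ?_⟩, 1, odd_one, by simp⟩
  rw [div_le_one (by positivity)]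
  exact one_le_pow₀ one_le_two

lemma dense_iUnion_dyadicLevel (S : Type*) [Infinite S] : Dense (⋃ n, dyadicLevel S n) := by
  classical
  rw [dense_iff_inter_open]
  rintro W hW ⟨y, hy⟩
  obtain ⟨F, u, hu, hsub⟩ := isOpen_pi_iff.1 hW y hy
  have hev : ∀ᶠ n in Filter.atTop, ∀ α ∈ F, (dyadicPoints n ∩ u α).Nonempty :=
    (F.eventually_all).2 fun α hα =>
      eventually_dyadicPoints_inter_nonempty (hu α hα).1 ⟨_, (hu α hα).2⟩
  obtain ⟨n, hn, hcard⟩ := (hev.and (Filter.eventually_ge_atTop F.card)).exists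
  choose! v hv using hn
  obtain ⟨t, ht⟩ := dyadicPoints_nonempty n
  obtain ⟨x, hx, hxv⟩ := exists_mem_dyadicLevel F (by omega) v (fun α hα => (hv α hα).1) ht
  exact ⟨x, hsub fun α hα => hxv α hα ▸ (hv α hα).2, mem_iUnion_of_mem n hx⟩

lemma mk_dyadicLevel {S : Type u} (hS : ℵ₀ < #S) (n : ℕ) : #(dyadicLevel S n) = #S := by
  have : Infinite S := infinite_iff.2 hS.le
  apply le_antisymm
  · let φ : dyadicLevel S n → (S →₀ ℕ) := fun x =>
      Finsupp.onFinset (finite_support_of_mem_dyadicLevel x.2).toFinset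
        (fun α => ⌊(x.1 α : ℝ) * 2 ^ n⌋₊) (by
          intro α h
          rw [Finite.mem_toFinset]
          intro h0
          simp [h0] at h)
    have hval : ∀ (x : dyadicLevel S n) (α : S), (x.1 α : ℝ) * 2 ^ n = φ x α := by
      intro x α
      change _ = ((⌊(x.1 α : ℝ) * 2 ^ n⌋₊ : ℕ) : ℝ)
      by_cases h0 : x.1 α = 0
      · simp [h0]
      · obtain ⟨k, -, hk⟩ := x.2.2 α h0
        rw [hk, Nat.floor_natCast]
    have hinj : Function.Injective φ := by
      intro x y hxy
      refine Subtype.ext (funext fun α => Subtype.ext ?_)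
      refine mul_right_cancel₀ (b := (2 : ℝ) ^ n) (by positivity) ?_
      rw [hval, hval, hxy]
    refine (mk_le_of_injective hinj).trans ?_
    rw [mk_finsupp_nat, max_eq_left hS.le]
  · have hcover : (⋃ x : dyadicLevel S n, {α | x.1 α ≠ 0}) = Set.univ := by
      refine eq_univ_of_forall fun α => ?_
      obtain ⟨t, ht⟩ := dyadicPoints_nonempty n
      obtain ⟨x, hx, hxt⟩ := exists_mem_dyadicLevel {α} (by simp) (fun _ => t) (fun _ _ => ht) ht
      refine mem_iUnion.2 ⟨⟨x, hx⟩, ?_⟩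
      change x α ≠ 0
      rw [hxt α (Finset.mem_singleton_self α)]
      exact ne_zero_of_mem_dyadicPoints ht
    -- The finite supports cover `S`; uncountability of `S` then rules out a smaller level.
    have hle : #S ≤ #(dyadicLevel S n) * ℵ₀ := by
      rw [← mk_univ (α := S), ← hcover]
      refine (mk_iUnion_le _).trans (mul_le_mul_right (ciSup_le' fun x => ?_) _)
      exact (finite_support_of_mem_dyadicLevel x.2).lt_aleph0.le
    by_contra! hlt
    exact (hle.trans_lt (mul_lt_of_lt hS.le hlt hS)).false

lemma isUspenskiiExample_iUnion_dyadicLevel {S : Type u} (hS : ℵ₀ < #S) :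
    IsUspenskiiExample (⋃ n, dyadicLevel S n) := by
  have : Infinite S := infinite_iff.2 hS.le
  refine ⟨dense_iUnion_dyadicLevel S, ⟨fun n => Subtype.val ⁻¹' dyadicLevel S n,
    fun n => ⟨?_, ?_, ?_⟩, ?_⟩, ?_, ⟨insert 0 (⋃ n, dyadicPoints n),
    (countable_iUnion fun n => (finite_dyadicPoints n).countable).insert 0, ?_⟩⟩
  · beta_reduce
    rw [dyadicLevel_eq_inter, preimage_inter, Subtype.coe_preimage_self, univ_inter]
    exact (isClosed_setOf_mem_insert_dyadicPoints S n).preimage continuous_subtype_val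
  · exact (isDiscrete_dyadicLevel S n).preimage continuous_subtype_val.continuousOn
      Subtype.val_injective
  · rw [mk_preimage_of_injective_of_subset_range _ _ Subtype.val_injective, mk_dyadicLevel hS]
    rw [Subtype.range_coe]
    exact subset_iUnion _ n
  · rw [← preimage_iUnion, Subtype.coe_preimage_self]
  · intro x hx
    obtain ⟨n, hn⟩ := mem_iUnion.1 hx
    exact finite_support_of_mem_dyadicLevel hn
  · rintro x hx _ ⟨α, rfl⟩
    obtain ⟨n, hn⟩ := mem_iUnion.1 hx
    exact or_iff_not_imp_left.2 fun h => mem_iUnion_of_mem n (hn.2 α h)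

theorem mainTheorem4 (κ : Cardinal.{u}) (hκ : ℵ₀ < κ) (S : Type u) (hS : #S = κ) :
    (∃ X : Set (S → unitInterval), IsUspenskiiExample X) ∧
    ∀ X : Set (S → unitInterval), IsUspenskiiExample X →
      #X = κ ∧
      FunctionallyCountable X ∧
      IsGδ (diagonal X) ∧
      extent X = κ ∧
      ¬ ExponentiallySeparable X := by
  subst hS
  refine ⟨⟨_, isUspenskiiExample_iUnion_dyadicLevel hκ⟩, fun X hX => ?_⟩
  obtain ⟨D, hD, hU⟩ := hX.sigma_closed_discrete
  exact ⟨hX.mk_eq hκ.le, hX.functionallyCountable,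
    isGδ_diagonal_of_iUnion_closed_discrete (fun n => ⟨(hD n).1, (hD n).2.1⟩) hU,
    hX.extent_eq hκ.le,
    not_exponentiallySeparable_of_closed_discrete (hD 0).1 (hD 0).2.1 ((hD 0).2.2 ▸ hκ)⟩
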